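/- Let $p>5$ be a prime. Then $$\frac1p\sum_{k=(p+1)/2}^{p-1}\frac{\binom{2k}{k}}{(2k+1)^2(-16)^k}\equiv-\sum_{k=0}^{(p-3)/2}\frac{(-16)^k}{(2k+1)^3\binom{2k}{k}}\equiv-\frac{B_{p-3}}{4}\pmod p,$$ where $B_0,B_1,B_2,\ldots$ are the Bernoulli numbers, and $x\equiv y\pmod p$ for rational numbers $x,y$ means that the denominators of $x$ and $y$ in lowest terms are not divisible by $p$ and $p$ divides the numerator of $x-y$ in lowest terms. -/

import Mathlib

/-- Congruence of rational numbers modulo a natural number `m`: both numbers are `m`-integral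
(their reduced denominators are coprime to `m`) and the numerator of their difference, in lowest
terms, is divisible by `m`. For `m = p` prime this is congruence modulo `p` in the ring of
`p`-integral rationals, the localization of the integers at the prime ideal generated by `p`. -/
def RatCongr (m : ℕ) (x y : ℚ) : Prop :=
  x.den.Coprime m ∧ y.den.Coprime m ∧ (m : ℤ) ∣ (x - y).num

/-! Write `p = 2n + 1`. In the upper sum put `k = p - 1 - j`. Wilson's theorem shows that
`C(2k,k)/p` is `-1/((2j+1) C(2j,j))` modulo `p`, so the first congruence holds term by term
(`hasReduction_upper_centralBinom_sum`). Reflecting the lower sum by `k ↦ n - k` and using `C(2k,k)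
= (-4)^k C(n,k)` modulo `p` turns it into `-S/8`, where `S = ∑_{1≤k≤n} (-1)^k / (k^3 C(2k,k))`.

The core is to evaluate `S` modulo `p`. A finite form of Apéry's identity (`sum_aperyTerm`) gives `∑
(-1)^k / (k^3 C(n,k) C(n+k,k)) = 2 H + 5 S` with `H = ∑_{k≤n} 1/k^3`. Modulo `p` the left side is `∑
16^k / (k^3 C(2k,k)^2)`, because `C(n+k,k)` and `C(2k,k)` both reduce to multiples of `C(n,k)`.
Expanding `16^k` over odd harmonic numbers `O_a` and exchanging the sums
(`sum_sixteen_pow_div_centralBinom_sq`) makes it `-8 ∑ O_a / a^2`.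

Reflection and parity splitting of double harmonic sums (`sum_oddHarmonic_mul`) give `-8 ∑ O_a / a^2
= 7 H` and `H = -2 ∑_{a<s<p} 1/(a s^2)`. So `7H = 2H + 5S`, hence `S = H`. Faulhaber's formula
identifies the last double sum with `B_{p-3}` (`hasReduction_bernoulli_harmonicSum`), so `S = -2
B_{p-3}` and the lower sum is `B_{p-3}/4`. -/

/-- `oddHarmonic F a = ∑_{j ≤ a} 1 / (2 j - 1)`. -/
def oddHarmonic (F : Type*) [Field F] (a : ℕ) : F := ∑ j ∈ Finset.range a, (2 * (j : F) + 1)⁻¹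

/-- `powHarmonic F r N = ∑_{1 ≤ k ≤ N} 1 / k ^ r`. -/
def powHarmonic (F : Type*) [Field F] (r N : ℕ) : F :=
  ∑ k ∈ Finset.range N, (((k : F) + 1) ^ r)⁻¹

lemma powHarmonic_succ (F : Type*) [Field F] (r N : ℕ) :
    powHarmonic F r (N + 1) = powHarmonic F r N + (((N : F) + 1) ^ r)⁻¹ :=
  Finset.sum_range_succ _ _

lemma oddHarmonic_succ (F : Type*) [Field F] (N : ℕ) :
    oddHarmonic F (N + 1) = oddHarmonic F N + (2 * (N : F) + 1)⁻¹ :=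
  Finset.sum_range_succ _ _

/-! ### Apéry's finite identity -/

open Nat in
/-- The summand `(-1)^k / (k^3 C(N,k) C(N+k,k))`, written with factorials. -/
def aperyTerm (F : Type*) [Field F] (N k : ℕ) : F :=
  (-1) ^ k * (k ! : F) ^ 2 * ((N - k)! : F) / ((k : F) ^ 3 * ((N + k)! : F))

lemma factorial_cast_ne_zero_of_le {F : Type*} [Field F] {M : ℕ}
    (h : ∀ m : ℕ, 0 < m → m ≤ M → (m : F) ≠ 0) {m : ℕ} (hm : m ≤ M) :
    (m.factorial : F) ≠ 0 := by
  induction m with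
  | zero => simp
  | succ m ih =>
    rw [Nat.factorial_succ, Nat.cast_mul]
    exact mul_ne_zero (h _ m.succ_pos hm) (ih (by omega))

lemma choose_cast_ne_zero_of_le {F : Type*} [Field F] {M : ℕ}
    (h : ∀ m : ℕ, 0 < m → m ≤ M → (m : F) ≠ 0) {m k : ℕ} (hm : m ≤ M) (hk : k ≤ m) :
    (m.choose k : F) ≠ 0 := by
  have h1 := factorial_cast_ne_zero_of_le h hm
  rw [← Nat.choose_mul_factorial_mul_factorial hk] at h1
  push_cast at h1
  exact left_ne_zero_of_mul (left_ne_zero_of_mul h1)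

-- For fixed `M`, the difference of consecutive Apéry summands telescopes in `k`; the right side is
-- the resulting closed form of the partial sum.
open Nat in
lemma sum_aperyTerm_succ_sub {F : Type*} [Field F] (M : ℕ)
    (h : ∀ m : ℕ, 0 < m → m ≤ 2 * (M + 1) → (m : F) ≠ 0) (K : ℕ) (hK : K ≤ M) :
    ∑ k ∈ Finset.range K, (aperyTerm F (M + 1) (k + 1) - aperyTerm F M (k + 1)) =
      2 / ((M : F) + 1) ^ 3 -
        2 * (-1) ^ K * (K ! : F) ^ 2 * ((M - K)! : F) /
          (((M : F) + 1) ^ 2 * ((M + 1 + K)! : F)) := by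
  have hM : (M : F) + 1 ≠ 0 := by exact_mod_cast h (M + 1) (by omega) (by omega)
  induction K with
  | zero =>
    have h1 : (M ! : F) ≠ 0 := factorial_cast_ne_zero_of_le h (by omega)
    simp only [Finset.range_zero, Finset.sum_empty, pow_zero, Nat.factorial_zero, Nat.sub_zero,
      Nat.add_zero, Nat.factorial_succ, Nat.cast_mul, Nat.cast_one, Nat.cast_add]
    field_simp
    ring
  | succ K ih =>
    rw [Finset.sum_range_succ, ih (by omega)]
    obtain ⟨d, rfl⟩ : ∃ d, M = K + 1 + d := ⟨M - (K + 1), by omega⟩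
    have e1 : K + 1 + d + 1 - (K + 1) = d + 1 := by omega
    have e2 : K + 1 + d - (K + 1) = d := by omega
    have e3 : K + 1 + d - K = d + 1 := by omega
    have e4 : K + 1 + d + 1 + (K + 1) = (2 * K + d + 2) + 1 := by omega
    have e5 : K + 1 + d + (K + 1) = 2 * K + d + 2 := by omega
    have e6 : K + 1 + d + 1 + K = 2 * K + d + 2 := by omega
    simp only [aperyTerm, e1, e2, e3, e4, e5, e6, Nat.factorial_succ]
    have f1 : (K ! : F) ≠ 0 := factorial_cast_ne_zero_of_le h (by omega)
    have f2 : (d ! : F) ≠ 0 := factorial_cast_ne_zero_of_le h (by omega)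
    have f3 : ((2 * K + d + 2)! : F) ≠ 0 := factorial_cast_ne_zero_of_le h (by omega)
    have f4 : (K : F) + 1 ≠ 0 := by exact_mod_cast h (K + 1) (by omega) (by omega)
    have f5 : ((2 * K + d + 2 + 1 : ℕ) : F) ≠ 0 := h _ (by omega) (by omega)
    push_cast at hM f5 ⊢
    field_simp
    ring

open Nat in
/-- The finite form of Apéry's identity behind `ζ(3) = 5/2 ∑ (-1)^(k-1) / (k^3 C(2k,k))`. -/
lemma sum_aperyTerm {F : Type*} [Field F] (N : ℕ)
    (h : ∀ m : ℕ, 0 < m → m ≤ 2 * N → (m : F) ≠ 0) :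
    ∑ k ∈ Finset.range N, aperyTerm F N (k + 1) =
      2 * powHarmonic F 3 N +
        5 * ∑ k ∈ Finset.range N,
          (-1) ^ (k + 1) / (((k : F) + 1) ^ 3 * (Nat.choose (2 * (k + 1)) (k + 1) : F)) := by
  induction N with
  | zero => simp [powHarmonic]
  | succ M ih =>
    have ih := ih fun m h1 h2 => h m h1 (by omega)
    have h1 := sum_aperyTerm_succ_sub M h M le_rfl
    rw [Finset.sum_sub_distrib, sub_eq_iff_eq_add] at h1
    rw [Finset.sum_range_succ, h1, ih, powHarmonic_succ, Finset.sum_range_succ]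
    have hM : (M : F) + 1 ≠ 0 := by exact_mod_cast h (M + 1) (by omega) (by omega)
    have f1 : (M ! : F) ≠ 0 := factorial_cast_ne_zero_of_le h (by omega)
    have f2 : ((2 * M + 1)! : F) ≠ 0 := factorial_cast_ne_zero_of_le h (by omega)
    have f3 : ((2 * M + 2 : ℕ) : F) ≠ 0 := h _ (by omega) (by omega)
    have f4 : (Nat.choose (2 * (M + 1)) (M + 1) : F) ≠ 0 :=
      choose_cast_ne_zero_of_le h le_rfl (by omega)
    have e : (Nat.choose (2 * (M + 1)) (M + 1) : F) * ((M + 1 : F) * M !) ^ 2 =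
        (2 * M + 2) * (2 * M + 1)! := by
      have := Nat.choose_mul_factorial_mul_factorial (show M + 1 ≤ 2 * (M + 1) by omega)
      rw [show 2 * (M + 1) - (M + 1) = M + 1 by omega,
        show (2 * (M + 1))! = (2 * M + 2) * (2 * M + 1)! from Nat.factorial_succ (2 * M + 1),
        Nat.factorial_succ M] at this
      replace this := congrArg (Nat.cast : ℕ → F) this
      push_cast at this
      rw [← this]; ring
    push_cast at f3
    have e' : ((M ! : F)) ^ 2 / (2 * M + 1)! =
        2 / ((M + 1) * (Nat.choose (2 * (M + 1)) (M + 1) : F)) := by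
      rw [div_eq_div_iff f2 (mul_ne_zero hM f4)]
      apply mul_left_cancel₀ hM
      linear_combination e
    have t1 : aperyTerm F (M + 1) (M + 1) =
        (-1) ^ (M + 1) / (((M : F) + 1) ^ 3 * (Nat.choose (2 * (M + 1)) (M + 1) : F)) := by
      have e2 : (M + 1 + (M + 1))! = (2 * M + 2) * (2 * M + 1)! := by
        rw [← Nat.factorial_succ]; congr 1; omega
      rw [aperyTerm, e2, Nat.sub_self, Nat.factorial_zero, Nat.factorial_succ M]
      push_cast
      rw [← e]
      field_simp
    -- The telescoping boundary contributes `4` copies of the new central binomial term and the new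
    -- last summand `t1` one more: this is the coefficient `5`.
    have t2 : 2 * (-1) ^ M * (M ! : F) ^ 2 * ((M - M)! : F) /
          (((M : F) + 1) ^ 2 * ((M + 1 + M)! : F)) =
        -4 * ((-1) ^ (M + 1) / (((M : F) + 1) ^ 3 * (Nat.choose (2 * (M + 1)) (M + 1) : F))) := by
      rw [show M + 1 + M = 2 * M + 1 by omega, Nat.sub_self, Nat.factorial_zero, Nat.cast_one,
        mul_one]
      rw [show 2 * (-1) ^ M * (M ! : F) ^ 2 / (((M : F) + 1) ^ 2 * ((2 * M + 1)! : F)) =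
        2 * (-1) ^ M / ((M : F) + 1) ^ 2 * ((M ! : F) ^ 2 / (2 * M + 1)!) by
          field_simp, e']
      field_simp
      ring
    rw [t1, t2]
    field_simp
    ring

/-! ### Binomial sums weighted by odd harmonic numbers -/

lemma odd_mul_choose_add_choose (K M : ℕ) :
    (2 * M + 1) * (2 * K + 3).choose (K + 2 + M) + (2 * K + 3) * (2 * K + 1).choose (K + M + 2) =
      (2 * K + 3) * (2 * K + 1).choose (K + M) := by
  have p1 : (2 * K + 2).choose (K + M + 1) =
      (2 * K + 1).choose (K + M) + (2 * K + 1).choose (K + M + 1) := Nat.choose_succ_succ _ _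
  have p2 : (2 * K + 2).choose (K + M + 2) =
      (2 * K + 1).choose (K + M + 1) + (2 * K + 1).choose (K + M + 2) := Nat.choose_succ_succ _ _
  have p3 : (2 * K + 3).choose (K + M + 2) =
      (2 * K + 2).choose (K + M + 1) + (2 * K + 2).choose (K + M + 2) := Nat.choose_succ_succ _ _
  have a1 : (2 * K + 3) * (2 * K + 2).choose (K + M + 1) =
      (2 * K + 3).choose (K + M + 2) * (K + M + 2) := Nat.add_one_mul_choose_eq _ _
  rw [show K + 2 + M = K + M + 2 by omega]
  zify at *
  linear_combination (2 * K + 3 : ℤ) * p1 - (2 * K + 3 : ℤ) * p2 - 2 * a1 - (2 * K + 3 : ℤ) * p3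

/-- Each weighted binomial is `2K + 3` times a difference of two entries of row `2K + 1` two places
apart, so the alternating sum collapses to two adjacent boundary entries. -/
lemma sum_alternating_odd_mul_choose (K M : ℕ) :
    ∑ i ∈ Finset.range M, (-1 : ℤ) ^ (i + 1) * (2 * i + 1) * (2 * K + 3).choose (K + 2 + i) =
      (2 * K + 3) * ((-1) ^ (M + 1) * (2 * K + 1).choose (K + M + 1) +
        (-1) ^ M * (2 * K + 1).choose (K + M)) := by
  induction M with
  | zero =>
    have : (2 * K + 1).choose (K + 1) = (2 * K + 1).choose K := by
      rw [← Nat.choose_symm (by omega)]; congr 1; omega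
    simp [this]
  | succ M ih =>
    rw [Finset.sum_range_succ, ih]
    have := odd_mul_choose_add_choose K M
    rw [show K + (M + 1) + 1 = K + M + 2 by ring, show K + (M + 1) = K + M + 1 by ring]
    zify at this
    linear_combination (-1) ^ (M + 1) * this

lemma sq_mul_choose_eq (K i : ℕ) :
    (2 * K + 3) * ((2 * K + 3) * (2 * K + 3).choose (K + 2 + i)) =
      (2 * i + 1) ^ 2 * (2 * K + 3).choose (K + 2 + i) +
        8 * (K + 1) * (2 * K + 3) * (2 * K + 1).choose (K + 1 + i) := by
  have a1 : (2 * K + 3) * (2 * K + 2).choose (K + i + 1) =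
      (2 * K + 3).choose (K + i + 2) * (K + i + 2) := Nat.add_one_mul_choose_eq _ _
  have a2 : (2 * K + 2).choose (K + i + 1) * ((2 * K + 2 : ℕ) - (K + i + 1 : ℕ) : ℤ) =
      (2 * K + 2) * (2 * K + 1).choose (K + i + 1) := by
    rcases le_or_gt (K + i + 1) (2 * K + 1) with hle | hlt
    · have := Nat.choose_mul_succ_eq (2 * K + 1) (K + i + 1)
      rw [← Nat.cast_sub (by omega)]
      rw [mul_comm] at this
      exact_mod_cast this.symm
    · rw [Nat.choose_eq_zero_of_lt hlt]
      rcases Nat.lt_or_ge (2 * K + 2) (K + i + 1) with h1 | h1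
      · rw [Nat.choose_eq_zero_of_lt h1]; simp
      · have : K + i + 1 = 2 * K + 2 := by omega
        rw [this]; simp
  rw [show K + 2 + i = K + i + 2 by omega, show K + 1 + i = K + i + 1 by omega]
  zify at *
  linear_combination (4 * (2 * K + 3) : ℤ) * a2 - (4 * (K + 1 - i : ℤ)) * a1

/-- After division by `2i + 1`, `sq_mul_choose_eq` relates the sums for `K + 1` and `K`. The
leftover, weighted by `2i + 1`, telescopes to zero, and the recurrence of central binomials supplies
the factor `16`. -/
lemma sum_alternating_choose_div_odd {F : Type*} [Field F] (K : ℕ)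
    (h : ∀ m : ℕ, 0 < m → m ≤ 2 * K + 2 → (m : F) ≠ 0) :
    8 * ((K : F) + 1) * (2 * (K + 1)).choose (K + 1) *
      ∑ i ∈ Finset.range (K + 1), (-1 : F) ^ (i + 1) * (2 * K + 1).choose (K + 1 + i) *
        (2 * (i : F) + 1)⁻¹ = -16 ^ (K + 1) := by
  induction K with
  | zero => norm_num
  | succ K ih =>
    have ih := ih fun m h1 h2 => h m h1 (by omega)
    have hz := sum_alternating_odd_mul_choose K (K + 2)
    rw [Nat.choose_eq_zero_of_lt (show 2 * K + 1 < K + (K + 2) + 1 by omega),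
      Nat.choose_eq_zero_of_lt (show 2 * K + 1 < K + (K + 2) by omega)] at hz
    have hz := congrArg (Int.cast : ℤ → F) hz
    push_cast at hz
    have key : (2 * K + 3 : F) * ((2 * K + 3 : F) *
        ∑ i ∈ Finset.range (K + 1 + 1), (-1 : F) ^ (i + 1) *
          (2 * (K + 1) + 1).choose (K + 1 + 1 + i) * (2 * (i : F) + 1)⁻¹) =
        (2 * K + 3 : F) * (8 * (K + 1) * ∑ i ∈ Finset.range (K + 1),
          (-1 : F) ^ (i + 1) * (2 * K + 1).choose (K + 1 + i) * (2 * (i : F) + 1)⁻¹) := by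
      have ext : ∑ i ∈ Finset.range (K + 1),
          (-1 : F) ^ (i + 1) * (2 * K + 1).choose (K + 1 + i) * (2 * (i : F) + 1)⁻¹ =
          ∑ i ∈ Finset.range (K + 2),
          (-1 : F) ^ (i + 1) * (2 * K + 1).choose (K + 1 + i) * (2 * (i : F) + 1)⁻¹ := by
        rw [Finset.sum_range_succ _ (K + 1), Nat.choose_eq_zero_of_lt (n := 2 * K + 1) (by omega)]
        simp
      rw [ext, ← sub_eq_zero, ← mul_zero (2 * K + 3 : F), mul_zero]
      simp only [Finset.mul_sum, ← Finset.sum_sub_distrib]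
      refine Eq.trans (Finset.sum_congr rfl fun i hi => ?_) (hz.trans (by ring))
      rw [Finset.mem_range] at hi
      have hi' : (2 * (i : F) + 1) ≠ 0 := by
        exact_mod_cast h (2 * i + 1) (by omega) (by omega)
      have := congrArg (Nat.cast : ℕ → F) (sq_mul_choose_eq K i)
      push_cast at this
      rw [show 2 * (K + 1) + 1 = 2 * K + 3 by ring, show K + 1 + 1 + i = K + 2 + i by ring]
      field_simp
      linear_combination this
    have h3 : (2 * K + 3 : F) ≠ 0 := by exact_mod_cast h (2 * K + 3) (by omega) (by omega)
    have key := mul_left_cancel₀ h3 key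
    have hc := congrArg (Nat.cast : ℕ → F) (Nat.succ_mul_centralBinom_succ (K + 1))
    rw [Nat.centralBinom, Nat.centralBinom] at hc
    push_cast at hc ⊢
    rw [pow_succ, ← neg_mul, ← ih]
    linear_combination 8 * (∑ i ∈ Finset.range (K + 1 + 1), (-1 : F) ^ (i + 1) *
          (2 * (K + 1) + 1).choose (K + 1 + 1 + i) * (2 * (i : F) + 1)⁻¹) * hc +
      16 * (2 * (K + 1)).choose (K + 1) * key

/-- Summation by parts: Pascal's rule makes the alternating binomials a difference, and the
increments of `oddHarmonic` are the odd reciprocals. -/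
lemma sum_choose_mul_oddHarmonic_partial {F : Type*} [Field F] (K M : ℕ) :
    ∑ a ∈ Finset.range M, (-1 : F) ^ (a + 1) * (2 * K + 2).choose (K + 2 + a) *
        oddHarmonic F (a + 1) =
      ∑ i ∈ Finset.range M, (-1 : F) ^ (i + 1) * (2 * K + 1).choose (K + 1 + i) *
        (2 * (i : F) + 1)⁻¹ -
      (-1) ^ (M + 1) * (2 * K + 1).choose (K + 1 + M) * oddHarmonic F M := by
  induction M with
  | zero => simp [oddHarmonic]
  | succ M ih =>
    have p : (2 * K + 2).choose (K + 2 + M) =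
        (2 * K + 1).choose (K + 1 + M) + (2 * K + 1).choose (K + 1 + M + 1) := by
      rw [show K + 2 + M = K + 1 + M + 1 by omega]; exact Nat.choose_succ_succ _ _
    rw [Finset.sum_range_succ, Finset.sum_range_succ, ih, oddHarmonic_succ, p]
    push_cast
    rw [show K + 1 + (M + 1) = K + 1 + M + 1 by ring]
    ring

lemma sum_choose_mul_oddHarmonic {F : Type*} [Field F] (K N : ℕ) (hN : K < N)
    (h : ∀ m : ℕ, 0 < m → m ≤ 2 * K + 2 → (m : F) ≠ 0) :
    8 * ((K : F) + 1) * (2 * (K + 1)).choose (K + 1) *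
      ∑ a ∈ Finset.range N, (-1 : F) ^ (a + 1) * (2 * (K + 1)).choose (K + 1 + (a + 1)) *
        oddHarmonic F (a + 1) = -16 ^ (K + 1) := by
  rw [← sum_alternating_choose_div_odd K h]
  congr 1
  have := sum_choose_mul_oddHarmonic_partial (F := F) K N
  rw [Nat.choose_eq_zero_of_lt (show 2 * K + 1 < K + 1 + N by omega)] at this
  simp only [show ∀ a, K + 1 + (a + 1) = K + 2 + a by intro a; ring, mul_add, mul_one] at this ⊢
  rw [this]
  simp only [Nat.cast_zero, mul_zero, zero_mul, sub_zero]
  symm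
  refine Finset.sum_subset (Finset.range_subset_range.2 hN) fun i _ hi => ?_
  rw [Finset.mem_range] at hi
  rw [Nat.choose_eq_zero_of_lt (show 2 * K + 1 < K + 1 + i by omega)]
  simp

/-- Telescopes in `N`. The recurrence `hrec` is used at `b = a` for the numerators and at `b = 0`
for the central binomials. -/
lemma sum_choose_div_centralBinom {F : Type*} [Field F] (N a : ℕ) (ha : 0 < a)
    (ha' : (a : F) ≠ 0) (h : ∀ m : ℕ, 0 < m → m ≤ 2 * N → (m : F) ≠ 0) :
    ∑ k ∈ Finset.range N, ((2 * (k + 1)).choose (k + 1 + a) : F) /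
        (((k : F) + 1) ^ 2 * (2 * (k + 1)).choose (k + 1)) =
      ((2 * N).choose (N + a) : F) / ((a : F) ^ 2 * (2 * N).choose N) := by
  induction N with
  | zero => simp [Nat.choose_eq_zero_of_lt ha]
  | succ N ih =>
    rw [Finset.sum_range_succ, ih fun m h1 h2 => h m h1 (by omega)]
    have hrec : ∀ b : ℕ, (((N : F) + 1) ^ 2 - (b : F) ^ 2) * (2 * (N + 1)).choose (N + 1 + b) =
        (2 * N + 2) * (2 * N + 1) * (2 * N).choose (N + b) := by
      intro b
      have a1 : (2 * N + 2) * (2 * N + 1).choose (N + b) =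
        (2 * N + 2).choose (N + b + 1) * (N + b + 1) := Nat.add_one_mul_choose_eq _ _
      have a2 : (2 * N + 1).choose (N + b) * ((2 * N + 1 : ℕ) - (N + b : ℕ) : ℤ) =
          (2 * N + 1) * (2 * N).choose (N + b) := by
        rcases le_or_gt (N + b) (2 * N) with hle | hlt
        · have := Nat.choose_mul_succ_eq (2 * N) (N + b)
          rw [← Nat.cast_sub (by omega)]
          rw [mul_comm] at this
          exact_mod_cast this.symm
        · rw [Nat.choose_eq_zero_of_lt hlt]
          rcases Nat.lt_or_ge (2 * N + 1) (N + b) with h1 | h1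
          · rw [Nat.choose_eq_zero_of_lt h1]; simp
          · have : N + b = 2 * N + 1 := by omega
            rw [this]; simp
      rw [show 2 * (N + 1) = 2 * N + 2 by ring, show N + 1 + b = N + b + 1 by ring]
      have b1 := congrArg (Nat.cast : ℕ → F) a1
      have b2 := congrArg (Int.cast : ℤ → F) a2
      push_cast at b1 b2
      linear_combination -((N : F) + 1 - b) * b1 + (2 * N + 2 : F) * b2
    have r0 := hrec 0
    have ra := hrec a
    have hN : (N : F) + 1 ≠ 0 := by exact_mod_cast h (N + 1) (by omega) (by omega)
    have c1 : ((2 * N).choose N : F) ≠ 0 := choose_cast_ne_zero_of_le h (by omega) (by omega)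
    have c2 : ((2 * (N + 1)).choose (N + 1) : F) ≠ 0 :=
      choose_cast_ne_zero_of_le h (by omega) (by omega)
    have o : (2 * (N : F) + 1) ≠ 0 := by exact_mod_cast h (2 * N + 1) (by omega) (by omega)
    have o2 : (2 * (N : F) + 2) ≠ 0 := by exact_mod_cast h (2 * N + 2) (by omega) (by omega)
    simp only [Nat.add_zero, Nat.cast_zero] at r0
    rw [div_add_div _ _ (by simp [ha', c1]) (by simp [hN, c2]),
      div_eq_div_iff (by simp [ha', c1, hN, c2]) (by simp [ha', c2])]
    apply mul_left_cancel₀ (mul_ne_zero o2 o)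
    linear_combination (a : F) ^ 2 * (2 * (N + 1)).choose (N + 1) *
      ((((N : F) + 1) ^ 2 - (a : F) ^ 2) * (2 * (N + 1)).choose (N + 1 + a) * r0 -
        ((N : F) + 1) ^ 2 * (2 * (N + 1)).choose (N + 1) * ra)

/-- `∑_k 16^k / (k^3 C(2k,k)^2)` as a double sum over odd harmonic numbers. -/
lemma sum_sixteen_pow_div_centralBinom_sq {F : Type*} [Field F] (N : ℕ)
    (h : ∀ m : ℕ, 0 < m → m ≤ 2 * N → (m : F) ≠ 0) :
    ∑ k ∈ Finset.range N, (16 : F) ^ (k + 1) /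
        (((k : F) + 1) ^ 3 * ((2 * (k + 1)).choose (k + 1) : F) ^ 2) =
      -8 * ∑ a ∈ Finset.range N, (-1 : F) ^ (a + 1) * oddHarmonic F (a + 1) *
        (((2 * N).choose (N + (a + 1)) : F) / (((a : F) + 1) ^ 2 * (2 * N).choose N)) := by
  have e1 : ∀ k ∈ Finset.range N, (16 : F) ^ (k + 1) /
        (((k : F) + 1) ^ 3 * ((2 * (k + 1)).choose (k + 1) : F) ^ 2) =
      ∑ a ∈ Finset.range N, -8 * ((-1 : F) ^ (a + 1) * oddHarmonic F (a + 1) *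
        (((2 * (k + 1)).choose (k + 1 + (a + 1)) : F) /
        (((k : F) + 1) ^ 2 * (2 * (k + 1)).choose (k + 1)))) := by
    intro k hk
    rw [Finset.mem_range] at hk
    have hk1 : (k : F) + 1 ≠ 0 := by exact_mod_cast h (k + 1) (by omega) (by omega)
    have c2 : ((2 * (k + 1)).choose (k + 1) : F) ≠ 0 :=
      choose_cast_ne_zero_of_le h (by omega) (by omega)
    have := sum_choose_mul_oddHarmonic (F := F) k N hk fun m h1 h2 => h m h1 (by omega)
    rw [← neg_neg ((16 : F) ^ (k + 1)), ← this, Finset.mul_sum, ← Finset.sum_neg_distrib,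
      Finset.sum_div]
    refine Finset.sum_congr rfl fun a _ => ?_
    field_simp
  rw [Finset.sum_congr rfl e1, Finset.sum_comm, Finset.mul_sum]
  refine Finset.sum_congr rfl fun a ha => ?_
  rw [Finset.mem_range] at ha
  have := sum_choose_div_centralBinom (F := F) N (a + 1) a.succ_pos
    (h _ (by omega) (by omega)) h
  rw [← Finset.mul_sum, ← Finset.mul_sum, this]
  push_cast
  rfl

/-! ### Harmonic sums in a field where `2n + 1 = 0`, modelling `ZMod p` -/

section HalfPrime

variable {F : Type*} [Field F] {n : ℕ}

lemma choose_two_mul_eq_neg_one_pow (hc : (2 * (n : F) + 1) = 0)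
    (h : ∀ m : ℕ, 0 < m → m ≤ 2 * n → (m : F) ≠ 0) {m : ℕ} (hm : m ≤ 2 * n) :
    ((2 * n).choose m : F) = (-1) ^ m := by
  induction m with
  | zero => simp
  | succ m ih =>
    have h1 := congrArg (Nat.cast : ℕ → F) (Nat.choose_succ_right_eq (2 * n) m)
    have h2 : ((m + 1 : ℕ) : F) ≠ 0 := h _ (by omega) hm
    rw [Nat.cast_mul, Nat.cast_mul, ih (by omega), Nat.cast_sub (by omega)] at h1
    apply mul_right_cancel₀ h2
    rw [h1]
    push_cast
    linear_combination (-1) ^ m * hc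

/-- Here `n` plays the role of `-1/2`, and `C(2k,k) = (-4)^k C(-1/2,k)`. -/
lemma centralBinom_eq_neg_four_pow_mul (hc : (2 * (n : F) + 1) = 0)
    (h : ∀ m : ℕ, 0 < m → m ≤ 2 * n → (m : F) ≠ 0) {k : ℕ} (hk : k ≤ n) :
    ((2 * k).choose k : F) = (-4) ^ k * (n.choose k : F) := by
  induction k with
  | zero => simp
  | succ k ih =>
    have h1 := congrArg (Nat.cast : ℕ → F) (Nat.choose_succ_right_eq n k)
    have h3 := congrArg (Nat.cast : ℕ → F) (Nat.succ_mul_centralBinom_succ k)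
    have h2 : ((k + 1 : ℕ) : F) ≠ 0 := h _ (by omega) (by omega)
    rw [Nat.centralBinom, Nat.centralBinom] at h3
    rw [Nat.cast_mul, Nat.cast_mul, Nat.cast_sub (by omega)] at h1
    push_cast at h1 h2 h3
    rw [ih (by omega)] at h3
    apply mul_left_cancel₀ h2
    rw [h3]
    linear_combination 4 * (-4) ^ k * h1 + 2 * (-4) ^ k * n.choose k * hc

lemma choose_add_eq_neg_one_pow_mul (hc : (2 * (n : F) + 1) = 0)
    (h : ∀ m : ℕ, 0 < m → m ≤ 2 * n → (m : F) ≠ 0) {k : ℕ} (hk : k ≤ n) :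
    ((n + k).choose k : F) = (-1) ^ k * (n.choose k : F) := by
  induction k with
  | zero => simp
  | succ k ih =>
    have h1 := congrArg (Nat.cast : ℕ → F) (Nat.choose_succ_right_eq n k)
    have h3 := congrArg (Nat.cast : ℕ → F) (Nat.add_one_mul_choose_eq (n + k) k)
    have h2 : ((k + 1 : ℕ) : F) ≠ 0 := h _ (by omega) (by omega)
    rw [Nat.cast_mul, Nat.cast_mul, Nat.cast_sub (by omega)] at h1
    push_cast at h1 h2 h3
    rw [ih (by omega)] at h3
    apply mul_right_cancel₀ h2
    rw [show n + (k + 1) = n + k + 1 by ring, ← h3]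
    linear_combination (-1) ^ k * h1 + (-1) ^ k * n.choose k * hc

lemma aperyTerm_eq_sixteen_pow_div (hc : (2 * (n : F) + 1) = 0)
    (h : ∀ m : ℕ, 0 < m → m ≤ 2 * n → (m : F) ≠ 0) {k : ℕ} (hk0 : 0 < k) (hk : k ≤ n) :
    aperyTerm F n k = 16 ^ k / ((k : F) ^ 3 * ((2 * k).choose k : F) ^ 2) := by
  have h1 := congrArg (Nat.cast : ℕ → F) (Nat.choose_mul_factorial_mul_factorial hk)
  have h2 := congrArg (Nat.cast : ℕ → F)
    (Nat.choose_mul_factorial_mul_factorial (Nat.le_add_left k n))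
  rw [Nat.add_sub_cancel] at h2
  push_cast at h1 h2
  rw [choose_add_eq_neg_one_pow_mul hc h hk] at h2
  have f1 : (k.factorial : F) ≠ 0 := factorial_cast_ne_zero_of_le h (by omega)
  have f2 : ((n - k).factorial : F) ≠ 0 := factorial_cast_ne_zero_of_le h (by omega)
  have c1 : (n.choose k : F) ≠ 0 := choose_cast_ne_zero_of_le h (by omega) hk
  have k0 : (k : F) ≠ 0 := h k hk0 (by omega)
  have h4 : (4 : F) ≠ 0 := by
    have : ((2 : ℕ) : F) ≠ 0 := h 2 (by omega) (by omega)
    rw [show (4 : F) = (2 : ℕ) * (2 : ℕ) by norm_num]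
    exact mul_ne_zero this this
  rw [aperyTerm, ← h2, ← h1, centralBinom_eq_neg_four_pow_mul hc h hk, mul_pow, ← pow_mul,
    mul_comm k 2, pow_mul, show ((-4 : F) ^ 2) = 16 by norm_num]
  have h16 : (16 : F) ^ k ≠ 0 := pow_ne_zero _ (by
    rw [show (16 : F) = 4 * 4 by norm_num]; exact mul_ne_zero h4 h4)
  field_simp

lemma powHarmonic_one_two_mul_sub (hc : (2 * (n : F) + 1) = 0)
    (m : ℕ) (hm : m ≤ 2 * n) :
    powHarmonic F 1 (2 * n - m) = powHarmonic F 1 (2 * n) + powHarmonic F 1 m := by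
  induction m with
  | zero => simp [powHarmonic]
  | succ m ih =>
    have ih := ih (by omega)
    rw [show 2 * n - m = 2 * n - (m + 1) + 1 by omega, powHarmonic_succ] at ih
    rw [powHarmonic_succ, ← add_assoc, ← ih, Nat.cast_sub hm]
    push_cast
    rw [show (2 * (n : F) - (m + 1) + 1) = -(m + 1) by linear_combination hc]
    simp only [pow_one, inv_neg]
    ring

lemma powHarmonic_one_two_mul (hc : (2 * (n : F) + 1) = 0) : powHarmonic F 1 (2 * n) = 0 := by
  have := powHarmonic_one_two_mul_sub hc n (by omega)
  rwa [show 2 * n - n = n by omega, right_eq_add] at this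

lemma powHarmonic_one_reflect (hc : (2 * (n : F) + 1) = 0) {m : ℕ} (hm : m ≤ 2 * n) :
    powHarmonic F 1 (2 * n - m) = powHarmonic F 1 m := by
  rw [powHarmonic_one_two_mul_sub hc m hm, powHarmonic_one_two_mul hc, zero_add]

lemma powHarmonic_two_two_mul (hc : (2 * (n : F) + 1) = 0) :
    powHarmonic F 2 (2 * n) = 2 * powHarmonic F 2 n := by
  have key : ∀ m ≤ 2 * n,
      powHarmonic F 2 (2 * n) = powHarmonic F 2 (2 * n - m) + powHarmonic F 2 m := by
    intro m hm
    induction m with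
    | zero => simp [powHarmonic]
    | succ m ih =>
      rw [ih (by omega), show 2 * n - m = 2 * n - (m + 1) + 1 by omega, powHarmonic_succ,
        powHarmonic_succ, Nat.cast_sub hm]
      push_cast
      rw [show (2 * (n : F) - (m + 1) + 1) = -(m + 1) by linear_combination hc]
      simp only [neg_sq]
      ring
  have := key n (by omega)
  rw [this, show 2 * n - n = n by omega]
  ring

/-- `harmonicSum F N = ∑_{1 ≤ a < s ≤ N} 1 / (a s^2)`. -/
def harmonicSum (F : Type*) [Field F] (N : ℕ) : F :=
  ∑ s ∈ Finset.range N, powHarmonic F 1 s * (((s : F) + 1) ^ 2)⁻¹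

lemma sum_powHarmonic_succ_mul (N : ℕ) :
    ∑ t ∈ Finset.range N, powHarmonic F 1 (t + 1) * (((t : F) + 1) ^ 2)⁻¹ =
      harmonicSum F N + powHarmonic F 3 N := by
  rw [harmonicSum, powHarmonic, ← Finset.sum_add_distrib]
  refine Finset.sum_congr rfl fun t _ => ?_
  rw [powHarmonic_succ, add_mul, ← mul_inv, ← pow_add]

/-- The substitution `s ↦ 2n + 1 - s` changes only the sign of `s` and fixes `H_s` up to the index
shift `H_{s-1}` to `H_s`. Applied to the upper half, it gives a second copy of the lower half plus
the diagonal `1/s^3`. -/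
lemma harmonicSum_two_mul (hc : (2 * (n : F) + 1) = 0) :
    harmonicSum F (2 * n) = 2 * harmonicSum F n + powHarmonic F 3 n := by
  have key : ∀ m ≤ 2 * n, harmonicSum F (2 * n) = harmonicSum F (2 * n - m) +
      ∑ t ∈ Finset.range m, powHarmonic F 1 (t + 1) * (((t : F) + 1) ^ 2)⁻¹ := by
    intro m hm
    induction m with
    | zero => simp
    | succ m ih =>
      rw [ih (by omega), show 2 * n - m = 2 * n - (m + 1) + 1 by omega, harmonicSum,
        Finset.sum_range_succ, Finset.sum_range_succ, ← harmonicSum,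
        powHarmonic_one_reflect hc hm, Nat.cast_sub hm]
      push_cast
      rw [show (2 * (n : F) - (m + 1) + 1) = -(m + 1) by linear_combination hc]
      simp only [neg_sq]
      ring
  rw [key n (by omega), sum_powHarmonic_succ_mul, show 2 * n - n = n by omega]
  ring

lemma powHarmonic_one_even (t : ℕ) :
    powHarmonic F 1 (2 * t) = oddHarmonic F t + powHarmonic F 1 t / 2 := by
  induction t with
  | zero => simp [powHarmonic, oddHarmonic]
  | succ t ih =>
    rw [show 2 * (t + 1) = 2 * t + 1 + 1 by ring, powHarmonic_succ, powHarmonic_succ, ih,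
      powHarmonic_succ, oddHarmonic_succ]
    push_cast
    rw [show (2 * (t : F) + 1 + 1) = 2 * (t + 1) by ring]
    simp only [pow_one, mul_inv]
    ring

/-- Splits by the parity of the squared denominator. Reflection turns the odd denominators into even
ones, so each pair involves only `H_{2t+2}` and `H_{2t+1}`, and `H_{2t}` is `O_t + H_t / 2`. -/
lemma harmonicSum_two_mul_eq_oddHarmonic (hc : (2 * (n : F) + 1) = 0) (h2 : (2 : F) ≠ 0) :
    harmonicSum F (2 * n) =
      (∑ t ∈ Finset.range n, oddHarmonic F (t + 1) * (((t : F) + 1) ^ 2)⁻¹) / 2 +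
        harmonicSum F n / 4 + powHarmonic F 3 n / 8 := by
  have pair : ∀ m, harmonicSum F (2 * m) =
      ∑ t ∈ Finset.range m, powHarmonic F 1 (2 * t) * ((2 * (t : F) + 1) ^ 2)⁻¹ +
      ∑ t ∈ Finset.range m, powHarmonic F 1 (2 * t + 1) * ((2 * (t : F) + 2) ^ 2)⁻¹ := by
    intro m
    induction m with
    | zero => simp [harmonicSum]
    | succ m ih =>
      rw [show 2 * (m + 1) = 2 * m + 1 + 1 by ring, harmonicSum, Finset.sum_range_succ,
        Finset.sum_range_succ, ← harmonicSum, ih, Finset.sum_range_succ, Finset.sum_range_succ]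
      push_cast
      rw [show (2 * (m : F) + 1 + 1) = 2 * m + 2 by ring]
      ring
  rw [pair, ← Finset.sum_range_reflect, ← Finset.sum_add_distrib]
  have h4 : (4 : F) ≠ 0 := by
    rw [show (4 : F) = 2 * 2 by norm_num]; exact mul_ne_zero h2 h2
  have h8 : (8 : F) ≠ 0 := by
    rw [show (8 : F) = 2 * 4 by norm_num]; exact mul_ne_zero h2 h4
  have term : ∀ t ∈ Finset.range n,
      powHarmonic F 1 (2 * (n - 1 - t)) * ((2 * ((n - 1 - t : ℕ) : F) + 1) ^ 2)⁻¹ +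
        powHarmonic F 1 (2 * t + 1) * ((2 * (t : F) + 2) ^ 2)⁻¹ =
      oddHarmonic F (t + 1) * (((t : F) + 1) ^ 2)⁻¹ / 2 +
        powHarmonic F 1 (t + 1) * (((t : F) + 1) ^ 2)⁻¹ / 4 - (((t : F) + 1) ^ 3)⁻¹ / 8 := by
    intro t ht
    rw [Finset.mem_range] at ht
    have e := powHarmonic_one_even (F := F) (t + 1)
    have e1 : powHarmonic F 1 (2 * (t + 1)) =
        powHarmonic F 1 (2 * t + 1) + (2 * ((t : F) + 1))⁻¹ := by
      rw [show 2 * (t + 1) = 2 * t + 1 + 1 by ring, powHarmonic_succ]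
      push_cast
      rw [show (2 * (t : F) + 1 + 1) = 2 * (t + 1) by ring, pow_one]
    rw [show 2 * (n - 1 - t) = 2 * n - 2 * (t + 1) by omega,
      powHarmonic_one_reflect hc (by omega), eq_sub_of_add_eq e1.symm, e,
      show n - 1 - t = n - (t + 1) by omega, Nat.cast_sub ht]
    push_cast
    rw [show (2 * ((n : F) - (t + 1)) + 1) = -(2 * (t + 1)) by linear_combination hc,
      show 2 * (t : F) + 2 = 2 * (t + 1) by ring, neg_sq]
    -- Nonvanishing of `t + 1` is not assumed; when it fails, `0⁻¹ = 0` kills both sides.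
    by_cases h0 : (t : F) + 1 = 0
    · simp [h0]
    field_simp
    ring
  rw [Finset.sum_congr rfl term, Finset.sum_sub_distrib, Finset.sum_add_distrib, ← Finset.sum_div,
    ← Finset.sum_div, ← Finset.sum_div, sum_powHarmonic_succ_mul, ← powHarmonic]
  field_simp
  ring

lemma oddHarmonic_eq_sub (hc : (2 * (n : F) + 1) = 0) (h2 : (2 : F) ≠ 0) {a : ℕ} (ha : a ≤ n) :
    oddHarmonic F a = (powHarmonic F 1 (n - a) - powHarmonic F 1 n) / 2 := by
  induction a with
  | zero => simp [oddHarmonic]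
  | succ a ih =>
    rw [oddHarmonic_succ, ih (by omega), show n - a = n - (a + 1) + 1 by omega, powHarmonic_succ,
      Nat.cast_sub ha]
    push_cast
    rw [show (2 * (a : F) + 1) = -(2 * ((n : F) - (a + 1) + 1)) by linear_combination hc, inv_neg,
      mul_inv, pow_one]
    field_simp
    ring

/-- Induction on `N` through the partial fractions of `1/(a^2 (s - a))` with `s = N + 1`. -/
lemma sum_powHarmonic_sub (N : ℕ) (h : ∀ m : ℕ, 0 < m → m ≤ N → (m : F) ≠ 0) :
    ∑ a ∈ Finset.range N, powHarmonic F 1 (N - (a + 1)) * (((a : F) + 1) ^ 2)⁻¹ =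
      powHarmonic F 1 N * powHarmonic F 2 N + harmonicSum F N - powHarmonic F 3 N := by
  induction N with
  | zero => simp [powHarmonic, harmonicSum]
  | succ N ih =>
    have hs : (N : F) + 1 ≠ 0 := by exact_mod_cast h (N + 1) (by omega) le_rfl
    have term : ∀ a ∈ Finset.range N,
        powHarmonic F 1 (N + 1 - (a + 1)) * (((a : F) + 1) ^ 2)⁻¹ =
        powHarmonic F 1 (N - (a + 1)) * (((a : F) + 1) ^ 2)⁻¹ +
          ((((a : F) + 1) ^ 2)⁻¹ * ((N : F) + 1)⁻¹ +
          ((((a : F) + 1) ^ 1)⁻¹ + ((((N - 1 - a : ℕ) : F) + 1) ^ 1)⁻¹) *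
            (((N : F) + 1) ^ 2)⁻¹) := by
      intro a ha
      rw [Finset.mem_range] at ha
      have ha1 : (a : F) + 1 ≠ 0 := by exact_mod_cast h (a + 1) (by omega) (by omega)
      have hb : ((N - a : ℕ) : F) ≠ 0 := h (N - a) (by omega) (by omega)
      rw [show N + 1 - (a + 1) = N - (a + 1) + 1 by omega, powHarmonic_succ,
        show N - 1 - a = N - (a + 1) by omega, Nat.cast_sub ha]
      rw [Nat.cast_sub ha.le] at hb
      push_cast
      rw [show (N : F) - (a + 1) + 1 = N - a by ring]
      field_simp
      ring
    have hrefl := Finset.sum_range_reflect (fun b : ℕ => (((b : F) + 1) ^ 1)⁻¹) N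
    rw [Finset.sum_range_succ, Finset.sum_congr rfl term, Finset.sum_add_distrib,
      Finset.sum_add_distrib, ← Finset.sum_mul, ← Finset.sum_mul, Finset.sum_add_distrib, hrefl,
      ih fun m h1 h2 => h m h1 (by omega), ← powHarmonic, ← powHarmonic, Nat.sub_self,
      powHarmonic_succ, powHarmonic_succ, powHarmonic_succ,
      harmonicSum, harmonicSum, Finset.sum_range_succ,
      show powHarmonic F 1 0 = 0 by simp [powHarmonic]]
    field_simp
    ring

/-- Three evaluations combine: the convolution `sum_powHarmonic_sub`, the reflection and the parity
split. Eliminating gives `4 harmonicSum F n = -3 powHarmonic F 3 n`, after cancelling a factor `3`.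
-/
lemma sum_oddHarmonic_mul (hc : (2 * (n : F) + 1) = 0)
    (h : ∀ m : ℕ, 0 < m → m ≤ 2 * n → (m : F) ≠ 0) (hn : 2 ≤ n) (hH : powHarmonic F 2 n = 0) :
    8 * ∑ t ∈ Finset.range n, oddHarmonic F (t + 1) * (((t : F) + 1) ^ 2)⁻¹ =
        -7 * powHarmonic F 3 n ∧
      powHarmonic F 3 n = -2 * harmonicSum F (2 * n) := by
  have h2 : (2 : F) ≠ 0 := by exact_mod_cast h 2 (by omega) (by omega)
  have h3 : (3 : F) ≠ 0 := by exact_mod_cast h 3 (by omega) (by omega)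
  have h4 : (4 : F) ≠ 0 := by exact_mod_cast h 4 (by omega) (by omega)
  have h8 : (8 : F) ≠ 0 := by
    rw [show (8 : F) = 2 * 4 by norm_num]; exact mul_ne_zero h2 h4
  have hV : ∑ t ∈ Finset.range n, oddHarmonic F (t + 1) * (((t : F) + 1) ^ 2)⁻¹ =
      (harmonicSum F n - powHarmonic F 3 n) / 2 := by
    have hW := sum_powHarmonic_sub (F := F) n fun m h1 h2 => h m h1 (by omega)
    rw [hH, mul_zero, zero_add] at hW
    have term : ∀ t ∈ Finset.range n, oddHarmonic F (t + 1) * (((t : F) + 1) ^ 2)⁻¹ =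
        powHarmonic F 1 (n - (t + 1)) * (((t : F) + 1) ^ 2)⁻¹ / 2 -
          powHarmonic F 1 n / 2 * (((t : F) + 1) ^ 2)⁻¹ := by
      intro t ht
      rw [Finset.mem_range] at ht
      rw [oddHarmonic_eq_sub hc h2 ht]
      ring
    rw [Finset.sum_congr rfl term, Finset.sum_sub_distrib, ← Finset.mul_sum, ← powHarmonic, hH,
      ← Finset.sum_div, hW]
    ring
  have e1 := harmonicSum_two_mul_eq_oddHarmonic hc h2
  have e2 := harmonicSum_two_mul hc
  rw [hV, e2] at e1
  have e3 : 4 * harmonicSum F n = -3 * powHarmonic F 3 n := by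
    have e8 : 8 * ((harmonicSum F n - powHarmonic F 3 n) / 2 / 2 + harmonicSum F n / 4 +
        powHarmonic F 3 n / 8) = 4 * harmonicSum F n - powHarmonic F 3 n := by
      field_simp
      ring
    apply mul_left_cancel₀ h3
    linear_combination 8 * e1 + e8
  constructor
  · rw [hV]
    field_simp
    linear_combination 2 * e3
  · rw [e2]
    linear_combination e3

/-- The half sum of `(-1)^k / (k^3 C(2k,k))` equals the third harmonic number. -/
lemma sum_neg_one_pow_div_cube_mul_centralBinom (hc : (2 * (n : F) + 1) = 0)
    (h : ∀ m : ℕ, 0 < m → m ≤ 2 * n → (m : F) ≠ 0) (hn : 3 ≤ n) (hH : powHarmonic F 2 n = 0) :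
    ∑ k ∈ Finset.range n,
      (-1) ^ (k + 1) / (((k : F) + 1) ^ 3 * (Nat.choose (2 * (k + 1)) (k + 1) : F)) =
      -2 * harmonicSum F (2 * n) := by
  obtain ⟨hO, hZ⟩ := sum_oddHarmonic_mul hc h (by omega) hH
  have h5 : (5 : F) ≠ 0 := by exact_mod_cast h 5 (by omega) (by omega)
  have hT := sum_aperyTerm (F := F) n h
  have hQ := sum_sixteen_pow_div_centralBinom_sq (F := F) n h
  have e : ∑ k ∈ Finset.range n, aperyTerm F n (k + 1) =
      -8 * ∑ t ∈ Finset.range n, oddHarmonic F (t + 1) * (((t : F) + 1) ^ 2)⁻¹ := by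
    refine Eq.trans (Finset.sum_congr rfl fun k hk => ?_) (hQ.trans ?_)
    · rw [Finset.mem_range] at hk
      rw [aperyTerm_eq_sixteen_pow_div hc h k.succ_pos hk]
      push_cast
      rfl
    · congr 1
      refine Finset.sum_congr rfl fun a ha => ?_
      rw [Finset.mem_range] at ha
      -- Row `2n = p - 1` of Pascal's triangle is `±1`, so the binomial quotient is `(-1)^(a+1)` and
      -- cancels the sign already present.
      rw [choose_two_mul_eq_neg_one_pow hc h (by omega),
        choose_two_mul_eq_neg_one_pow hc h (by omega), pow_add _ n]
      have hs : (-1 : F) ^ (a + 1) * (-1) ^ (a + 1) = 1 := by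
        rw [← mul_pow]; norm_num
      have hn0 : (-1 : F) ^ n ≠ 0 := pow_ne_zero _ (by norm_num)
      rw [mul_comm (((a : F) + 1) ^ 2), mul_div_mul_left _ _ hn0, div_eq_mul_inv]
      linear_combination oddHarmonic F (a + 1) * (((a : F) + 1) ^ 2)⁻¹ * hs
  rw [e] at hT
  rw [← hZ]
  -- What remains is `7H = 2H + 5S`; cancelling `5` is where `p > 5` is needed.
  apply mul_left_cancel₀ h5
  linear_combination -hT - hO

end HalfPrime

/-! ### Reduction of `p`-integral rationals -/

/-- `x` is `p`-integral with reduction `z` modulo `p`. -/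
def HasReduction (p : ℕ) (x : ℚ) (z : ZMod p) : Prop :=
  ∃ a b : ℤ, (b : ZMod p) ≠ 0 ∧ x * b = a ∧ z * b = a

namespace HasReduction

variable {p : ℕ} [Fact p.Prime] {x y : ℚ} {z w : ZMod p}

lemma intCast (a : ℤ) : HasReduction p (a : ℚ) (a : ZMod p) := ⟨a, 1, by simp, by simp, by simp⟩

lemma natCast (a : ℕ) : HasReduction p (a : ℚ) (a : ZMod p) := by
  simpa using intCast (p := p) (a : ℤ)

lemma add (hx : HasReduction p x z) (hy : HasReduction p y w) :
    HasReduction p (x + y) (z + w) := by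
  obtain ⟨a, b, hb, h1, h2⟩ := hx
  obtain ⟨c, d, hd, h3, h4⟩ := hy
  refine ⟨a * d + c * b, b * d, by push_cast; exact mul_ne_zero hb hd, ?_, ?_⟩
  · push_cast; linear_combination (d : ℚ) * h1 + b * h3
  · push_cast; linear_combination (d : ZMod p) * h2 + b * h4

lemma mul (hx : HasReduction p x z) (hy : HasReduction p y w) :
    HasReduction p (x * y) (z * w) := by
  obtain ⟨a, b, hb, h1, h2⟩ := hx
  obtain ⟨c, d, hd, h3, h4⟩ := hy
  refine ⟨a * c, b * d, by push_cast; exact mul_ne_zero hb hd, ?_, ?_⟩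
  · push_cast; linear_combination (y * d : ℚ) * h1 + a * h3
  · push_cast; linear_combination (w * d) * h2 + a * h4

lemma neg (hx : HasReduction p x z) : HasReduction p (-x) (-z) := by
  simpa using (intCast (p := p) (-1)).mul hx

lemma sub (hx : HasReduction p x z) (hy : HasReduction p y w) :
    HasReduction p (x - y) (z - w) := by
  simpa [sub_eq_add_neg] using hx.add hy.neg

lemma pow (hx : HasReduction p x z) (m : ℕ) : HasReduction p (x ^ m) (z ^ m) := by
  induction m with
  | zero => simpa using natCast (p := p) 1
  | succ m ih => simpa [pow_succ] using ih.mul hx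

lemma inv (hx : HasReduction p x z) (hz : z ≠ 0) : HasReduction p x⁻¹ z⁻¹ := by
  obtain ⟨a, b, hb, h1, h2⟩ := hx
  have ha : (a : ZMod p) ≠ 0 := h2 ▸ mul_ne_zero hz hb
  have hx0 : x ≠ 0 := by
    rintro rfl
    rw [zero_mul, eq_comm, Int.cast_eq_zero] at h1
    simp [h1] at ha
  exact ⟨b, a, ha, by rw [← h1, inv_mul_cancel_left₀ hx0], by rw [← h2, inv_mul_cancel_left₀ hz]⟩

lemma div (hx : HasReduction p x z) (hy : HasReduction p y w) (hw : w ≠ 0) :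
    HasReduction p (x / y) (z / w) := by
  simpa [div_eq_mul_inv] using hx.mul (hy.inv hw)

lemma sum {ι : Type*} (s : Finset ι) {f : ι → ℚ} {g : ι → ZMod p}
    (h : ∀ i ∈ s, HasReduction p (f i) (g i)) :
    HasReduction p (∑ i ∈ s, f i) (∑ i ∈ s, g i) := by
  classical
  induction s using Finset.induction_on with
  | empty => simpa using natCast (p := p) 0
  | insert i s hi ih =>
    rw [Finset.sum_insert hi, Finset.sum_insert hi]
    exact (h i (Finset.mem_insert_self i s)).add
      (ih fun j hj => h j (Finset.mem_insert_of_mem hj))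

/-- Lets an identity between rationals, such as Faulhaber's formula, be transferred to `ZMod p`. -/
lemma unique (hx : HasReduction p x z) (hy : HasReduction p x w) : z = w := by
  obtain ⟨a, b, hb, h1, h2⟩ := hx.sub hy
  rw [sub_self, zero_mul, eq_comm, Int.cast_eq_zero] at h1
  rw [h1, Int.cast_zero, mul_eq_zero, or_iff_left hb] at h2
  exact sub_eq_zero.1 h2

lemma den_coprime (hx : HasReduction p x z) : x.den.Coprime p := by
  obtain ⟨a, b, hb, h1, -⟩ := hx
  have hb0 : (b : ℚ) ≠ 0 := by
    rintro h
    rw [Int.cast_eq_zero] at h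
    simp [h] at hb
  have hd : (x.den : ℤ) ∣ b := by
    have := Rat.den_dvd a b
    rwa [Rat.divInt_eq_div, ← h1, mul_div_cancel_right₀ _ hb0] at this
  rw [Nat.coprime_comm, (Fact.out : p.Prime).coprime_iff_not_dvd]
  intro hp
  exact hb ((ZMod.intCast_zmod_eq_zero_iff_dvd b p).2 ((Int.natCast_dvd_natCast.2 hp).trans hd))

lemma dvd_num (hx : HasReduction p x 0) : (p : ℤ) ∣ x.num := by
  obtain ⟨a, b, hb, h1, h2⟩ := hx
  have h3 : x.num * b = a * x.den := by
    have := Rat.num_div_den x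
    have hd : (x.den : ℚ) ≠ 0 := by exact_mod_cast x.den_nz
    rw [← this, div_mul_eq_mul_div, div_eq_iff hd] at h1
    exact_mod_cast h1
  rw [← ZMod.intCast_zmod_eq_zero_iff_dvd]
  have h4 := congrArg (Int.cast : ℤ → ZMod p) h3
  push_cast at h4
  rw [← h2, zero_mul, zero_mul, mul_eq_zero, or_iff_left hb] at h4
  exact h4

lemma ratCongr (hx : HasReduction p x z) (hy : HasReduction p y z) : RatCongr p x y :=
  ⟨hx.den_coprime, hy.den_coprime, dvd_num (by simpa using hx.sub hy)⟩

end HasReduction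

/-! ### Bernoulli numbers, power sums and Wilson's theorem modulo `p` -/

section ZModPrime

variable {p : ℕ} [Fact p.Prime]

lemma natCast_zmod_ne_zero_of_lt {m : ℕ} (h0 : 0 < m) (h1 : m < p) : (m : ZMod p) ≠ 0 := by
  rw [Ne, ZMod.natCast_eq_zero_iff]
  exact Nat.not_dvd_of_pos_of_lt h0 h1

/-- The Bernoulli recursion only divides by integers between `2` and `j + 1`, all units modulo `p`.
-/
lemma exists_hasReduction_bernoulli (j : ℕ) (hj : j + 1 < p) :
    ∃ z : ZMod p, HasReduction p (bernoulli j) z := by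
  have h : ∃ z : ZMod p, HasReduction p (bernoulli' j) z := by
    induction j using Nat.strong_induction_on with
    | _ j ih =>
      rw [bernoulli'_def]
      have : ∀ k ∈ Finset.range j, ∃ z : ZMod p,
          HasReduction p ((j.choose k : ℚ) / (j - k + 1) * bernoulli' k) z := by
        intro k hk
        rw [Finset.mem_range] at hk
        obtain ⟨z, hz⟩ := ih k hk (by omega)
        have hd : ((j : ℚ) - k + 1) = ((j - k + 1 : ℕ) : ℚ) := by
          push_cast [Nat.cast_sub hk.le]; ring
        rw [hd]
        exact ⟨_, ((HasReduction.natCast _).div (HasReduction.natCast _)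
          (natCast_zmod_ne_zero_of_lt (by omega) (by omega))).mul hz⟩
      choose! z hz using this
      exact ⟨_, by simpa using (HasReduction.natCast 1).sub (HasReduction.sum _ hz)⟩
  obtain ⟨z, hz⟩ := h
  refine ⟨(-1) ^ j * z, ?_⟩
  have := ((HasReduction.intCast (p := p) (-1)).pow j).mul hz
  rw [bernoulli]
  simpa using this

lemma sum_range_succ_pow_zmod (l : ℕ) :
    ∑ k ∈ Finset.range (p - 1), ((k : ZMod p) + 1) ^ l = if p - 1 ∣ l then -1 else 0 := by
  have hp := (Fact.out : p.Prime).pos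
  have h : ∑ k ∈ Finset.range (p - 1), ((k : ZMod p) + 1) ^ l =
      ∑ u : (ZMod p)ˣ, (u : ZMod p) ^ l := by
    refine Finset.sum_bij'
      (fun k hk => Units.mk0 ((k + 1 : ℕ) : ZMod p)
        (natCast_zmod_ne_zero_of_lt k.succ_pos (by rw [Finset.mem_range] at hk; omega)))
      (fun u _ => (u : ZMod p).val - 1) (fun _ _ => Finset.mem_univ _) ?_ ?_ ?_ ?_
    · intro u _
      have h1 := ZMod.val_lt (u : ZMod p)
      have h2 : (u : ZMod p).val ≠ 0 := (ZMod.val_ne_zero _).2 u.ne_zero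
      rw [Finset.mem_range]
      omega
    · intro k hk
      rw [Finset.mem_range] at hk
      rw [Units.val_mk0, ZMod.val_cast_of_lt (by omega), Nat.add_sub_cancel]
    · intro u _
      have h2 : (u : ZMod p).val ≠ 0 := (ZMod.val_ne_zero _).2 u.ne_zero
      refine Units.ext ?_
      rw [Units.val_mk0, Nat.sub_add_cancel (by omega), ZMod.natCast_zmod_val]
    · intro k _
      rw [Units.val_mk0]
      push_cast
      rfl
  rw [h, FiniteField.sum_pow_units, ZMod.card]

lemma pow_prime_sub_two_zmod {x : ZMod p} (hx : x ≠ 0) : x ^ (p - 2) = x⁻¹ := by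
  have hp := (Fact.out : p.Prime).two_le
  apply eq_inv_of_mul_eq_one_left
  rw [← pow_succ, show p - 2 + 1 = p - 1 by omega, ZMod.pow_card_sub_one_eq_one hx]

lemma pow_prime_sub_three_zmod (hp : 2 < p) {x : ZMod p} (hx : x ≠ 0) :
    x ^ (p - 3) = (x ^ 2)⁻¹ := by
  apply eq_inv_of_mul_eq_one_left
  rw [← pow_add, show p - 3 + 2 = p - 1 by omega, ZMod.pow_card_sub_one_eq_one hx]

lemma powHarmonic_two_zmod (hp : 3 < p) : powHarmonic (ZMod p) 2 (p - 1) = 0 := by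
  have h := sum_range_succ_pow_zmod (p := p) (p - 3)
  rw [if_neg (Nat.not_dvd_of_pos_of_lt (by omega) (by omega))] at h
  rw [← h, powHarmonic]
  refine Finset.sum_congr rfl fun k hk => ?_
  rw [Finset.mem_range] at hk
  rw [pow_prime_sub_three_zmod (by omega)]
  exact_mod_cast natCast_zmod_ne_zero_of_lt (p := p) k.succ_pos (by omega)

lemma choose_prime_sub_one_zmod {m : ℕ} (hm : m < p) :
    ((p - 1).choose m : ZMod p) = (-1) ^ m := by
  have hp := (Fact.out : p.Prime).pos
  induction m with
  | zero => simp
  | succ m ih =>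
    have h1 := congrArg (Nat.cast : ℕ → ZMod p) (Nat.choose_succ_right_eq (p - 1) m)
    have h2 : ((m + 1 : ℕ) : ZMod p) ≠ 0 := natCast_zmod_ne_zero_of_lt m.succ_pos hm
    rw [Nat.cast_mul, Nat.cast_mul, ih (by omega), Nat.cast_sub (by omega), Nat.cast_sub hp,
      ZMod.natCast_self] at h1
    apply mul_right_cancel₀ h2
    rw [h1]
    push_cast
    ring

/-- Faulhaber's formula for harmonic numbers modulo `p`. -/
lemma powHarmonic_one_eq_sum_bernoulli {β : ℕ → ZMod p}
    (hβ : ∀ j, j + 1 < p → HasReduction p (bernoulli j) (β j)) {s : ℕ} (hs : s < p) (hp : 2 < p) :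
    powHarmonic (ZMod p) 1 s =
      -∑ i ∈ Finset.range (p - 1), β i * (p - 1).choose i * ((s : ZMod p) + 1) ^ (p - 1 - i) := by
  have h0 : powHarmonic (ZMod p) 1 s =
      ∑ k ∈ Finset.range (s + 1), (k : ZMod p) ^ (p - 2) := by
    rw [Finset.sum_range_succ', Nat.cast_zero, zero_pow (by omega), add_zero, powHarmonic]
    refine Finset.sum_congr rfl fun k hk => ?_
    rw [Finset.mem_range] at hk
    rw [pow_prime_sub_two_zmod (natCast_zmod_ne_zero_of_lt k.succ_pos (by omega))]
    push_cast
    rw [pow_one]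
  have h1 : HasReduction p (∑ k ∈ Finset.range (s + 1), (k : ℚ) ^ (p - 2))
      (∑ k ∈ Finset.range (s + 1), (k : ZMod p) ^ (p - 2)) :=
    HasReduction.sum _ fun k _ => (HasReduction.natCast k).pow _
  have hd : ((p - 2 : ℕ) : ℚ) + 1 = ((p - 1 : ℕ) : ℚ) := by
    rw [show p - 1 = p - 2 + 1 by omega]; push_cast; rfl
  have hm : ((p - 1 : ℕ) : ZMod p) = -1 := by
    rw [Nat.cast_sub (by omega), ZMod.natCast_self]; simp
  -- Faulhaber's denominator `p - 1` is `-1` modulo `p`, the source of the minus sign.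
  rw [sum_range_pow, show p - 2 + 1 = p - 1 by omega, hd] at h1
  have h2 := HasReduction.sum (Finset.range (p - 1)) fun i hi =>
    (((hβ i (by rw [Finset.mem_range] at hi; omega)).mul
      (HasReduction.natCast ((p - 1).choose i))).mul
      ((HasReduction.natCast (s + 1)).pow (p - 1 - i))).div (HasReduction.natCast (p - 1))
      (natCast_zmod_ne_zero_of_lt (by omega) (by omega))
  rw [h0, h1.unique h2, hm, ← Finset.sum_neg_distrib]
  refine Finset.sum_congr rfl fun i _ => ?_
  push_cast
  rw [div_neg, div_one]

/-- Substituting Faulhaber's formula for the inner harmonic number leaves power sums over nonzero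
residues with exponents from `p - 2` to `2p - 4`. Only the exponent `p - 1`, that is `i = p - 3`,
survives; it contributes `-1`, which cancels the sign in the formula. -/
lemma hasReduction_bernoulli_harmonicSum (hp : 3 < p) :
    HasReduction p (bernoulli (p - 3)) (harmonicSum (ZMod p) (p - 1)) := by
  have h : ∀ j, ∃ z : ZMod p, j + 1 < p → HasReduction p (bernoulli j) z := by
    intro j
    by_cases hj : j + 1 < p
    · obtain ⟨z, hz⟩ := exists_hasReduction_bernoulli j hj
      exact ⟨z, fun _ => hz⟩
    · exact ⟨0, fun h => absurd h hj⟩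
  choose β hβ using h
  have e : harmonicSum (ZMod p) (p - 1) = β (p - 3) := by
    have term : ∀ s ∈ Finset.range (p - 1),
        powHarmonic (ZMod p) 1 s * (((s : ZMod p) + 1) ^ 2)⁻¹ =
        ∑ i ∈ Finset.range (p - 1), -(β i * (p - 1).choose i) *
          ((s : ZMod p) + 1) ^ (p - 1 - i + (p - 3)) := by
      intro s hs
      rw [Finset.mem_range] at hs
      have hs1 : (s : ZMod p) + 1 ≠ 0 := by
        exact_mod_cast natCast_zmod_ne_zero_of_lt (p := p) s.succ_pos (by omega)
      rw [powHarmonic_one_eq_sum_bernoulli hβ (by omega) (by omega),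
        ← pow_prime_sub_three_zmod (by omega) hs1, neg_mul, Finset.sum_mul,
        ← Finset.sum_neg_distrib]
      refine Finset.sum_congr rfl fun i _ => ?_
      rw [pow_add]
      ring
    rw [harmonicSum, Finset.sum_congr rfl term, Finset.sum_comm,
      Finset.sum_eq_single_of_mem (p - 3) (by rw [Finset.mem_range]; omega)]
    · rw [← Finset.mul_sum, sum_range_succ_pow_zmod,
        if_pos (by rw [show p - 1 - (p - 3) + (p - 3) = p - 1 by omega]),
        choose_prime_sub_one_zmod (by omega), Even.neg_one_pow]
      · ring
      · have := (Fact.out : p.Prime).eq_two_or_odd'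
        rcases this with h | ⟨m, h⟩
        · omega
        · exact ⟨m - 1, by omega⟩
    · intro i hi hne
      rw [Finset.mem_range] at hi
      rw [← Finset.mul_sum, sum_range_succ_pow_zmod, if_neg, mul_zero]
      rintro ⟨c, hc⟩
      have h1 : c < 2 := by
        by_contra! h2
        have := Nat.mul_le_mul_left (p - 1) h2
        omega
      interval_cases c <;> omega
  rw [e]
  exact hβ _ (by omega)

lemma factorial_sub_mul_factorial_zmod {j : ℕ} (hj : j < p) :
    (((p - 1 - j).factorial : ZMod p)) * (j.factorial : ZMod p) = (-1) ^ (j + 1) := by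
  induction j with
  | zero => simp [ZMod.wilsons_lemma]
  | succ j ih =>
    have ih := ih (by omega)
    rw [show p - 1 - j = p - 1 - (j + 1) + 1 by omega, Nat.factorial_succ,
      show p - 1 - (j + 1) + 1 = p - (j + 1) by omega, Nat.cast_mul, Nat.cast_sub hj.le,
      ZMod.natCast_self] at ih
    rw [Nat.factorial_succ, pow_succ, ← ih]
    push_cast
    ring

/-- For `p / 2 < k < p` and `j = p - 1 - k`, the central binomial coefficient `C(2k,k)` is
`p` times a unit determined by `C(2j,j)`. -/
lemma exists_centralBinom_eq_prime_mul {j : ℕ} (hj : 2 * j + 1 < p) :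
    ∃ m : ℕ, (2 * (p - 1 - j)).choose (p - 1 - j) = p * m ∧
      (m : ZMod p) * ((2 * (j : ZMod p) + 1) * ((2 * j).choose j : ZMod p)) = -1 := by
  have hp := (Fact.out : p.Prime)
  set k := p - 1 - j with hk
  set r := p - 1 - (2 * j + 1) with hr
  have hch := Nat.choose_mul_factorial_mul_factorial (show k ≤ 2 * k by omega)
  -- Writes `(2k)! = p (p-1)! (p+1)⋯(p+r)`; after removing `p`, this is `-r!` modulo `p`.
  rw [show 2 * k - k = k by omega, show 2 * k = p + r by omega, ← Nat.factorial_mul_ascFactorial,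
    ← Nat.mul_factorial_pred hp.ne_zero] at hch
  have hpk : ¬ p ∣ k.factorial := by rw [hp.dvd_factorial]; omega
  have hdvd : p ∣ (p + r).choose k := by
    have : p ∣ (p + r).choose k * k.factorial * k.factorial := by
      rw [hch, mul_assoc]; exact dvd_mul_right _ _
    rcases hp.dvd_mul.1 this with h | h
    · exact (hp.dvd_mul.1 h).resolve_right hpk
    · exact absurd h hpk
  obtain ⟨m, hm⟩ := hdvd
  refine ⟨m, by rw [← hm]; congr 1; omega, ?_⟩
  rw [hm, mul_assoc, mul_assoc, mul_assoc] at hch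
  have h1 := congrArg (Nat.cast : ℕ → ZMod p) (Nat.eq_of_mul_eq_mul_left hp.pos hch)
  have hasc : (((p + 1).ascFactorial r : ℕ) : ZMod p) = (r.factorial : ZMod p) := by
    rw [Nat.ascFactorial_eq_prod_range, ← Finset.prod_range_add_one_eq_factorial]
    push_cast
    refine Finset.prod_congr rfl fun i _ => ?_
    rw [ZMod.natCast_self]
    ring
  push_cast at h1
  rw [hasc, ZMod.wilsons_lemma] at h1
  -- By Wilson, `k!^2` is inverse to `j!^2` and `r!` is inverse to `(2j+1)!`, so `m k!^2 = -r!`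
  -- becomes `m (2j+1)! = -j!^2`.
  have w1 := factorial_sub_mul_factorial_zmod (p := p) (show j < p by omega)
  have w2 := factorial_sub_mul_factorial_zmod hj
  rw [← hk] at w1
  rw [← hr, show 2 * j + 1 + 1 = (j + 1) * 2 by ring, pow_mul, Nat.factorial_succ] at w2
  have c := congrArg (Nat.cast : ℕ → ZMod p)
    (Nat.choose_mul_factorial_mul_factorial (show j ≤ 2 * j by omega))
  rw [show 2 * j - j = j by omega] at c
  have s1 : ((-1 : ZMod p) ^ (j + 1)) ^ 2 = 1 := by rw [← pow_mul, mul_comm, pow_mul]; simp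
  have w3 : (k.factorial * j.factorial : ZMod p) ^ 2 = 1 := by rw [w1, s1]
  rw [s1] at w2
  push_cast at c w2
  linear_combination (-(m : ZMod p) * (2 * j + 1) * (2 * j).choose j) * w3 +
    (j.factorial : ZMod p) ^ 2 * (2 * j + 1) * (2 * j).choose j * h1 -
    (r.factorial * (2 * j + 1) : ZMod p) * c - w2

end ZModPrime

/-! ### Comparison of the two sums and conclusion -/

/-- Pair `k` with `j + 1 = n - k`: then `2k + 1 = -2(j + 1)`, both central binomials reduce to the
same `C(n,k)`, and `4^n = 1` makes the powers of `4` match. The cube of `-2` gives `-1/8`. -/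
lemma sum_neg_sixteen_pow_div_odd_cube {F : Type*} [Field F] {n : ℕ} (hc : (2 * (n : F) + 1) = 0)
    (h : ∀ m : ℕ, 0 < m → m ≤ 2 * n → (m : F) ≠ 0) (h2 : (2 : F) ≠ 0) (h4 : (4 : F) ^ n = 1) :
    ∑ k ∈ Finset.range n, (-16 : F) ^ k / ((2 * (k : F) + 1) ^ 3 * ((2 * k).choose k : F)) =
      -(∑ k ∈ Finset.range n,
        (-1) ^ (k + 1) / (((k : F) + 1) ^ 3 * ((2 * (k + 1)).choose (k + 1) : F))) / 8 := by
  have f4 : (4 : F) ≠ 0 := by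
    rw [show (4 : F) = 2 * 2 by norm_num]; exact mul_ne_zero h2 h2
  have f8 : (8 : F) ≠ 0 := by
    rw [show (8 : F) = 2 * 4 by norm_num]; exact mul_ne_zero h2 f4
  rw [← Finset.sum_range_reflect, ← Finset.sum_neg_distrib, Finset.sum_div]
  refine Finset.sum_congr rfl fun j hj => ?_
  rw [Finset.mem_range] at hj
  obtain ⟨k, rfl⟩ : ∃ k, n = k + (j + 1) := ⟨n - (j + 1), by omega⟩
  have hj1 : (j : F) + 1 ≠ 0 := by exact_mod_cast h (j + 1) (by omega) (by omega)
  have c1 : ((k + (j + 1)).choose k : F) ≠ 0 := choose_cast_ne_zero_of_le h (by omega) (by omega)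
  push_cast at hc
  rw [show k + (j + 1) - 1 - j = k by omega,
    centralBinom_eq_neg_four_pow_mul (by exact_mod_cast hc) h (show k ≤ k + (j + 1) by omega),
    centralBinom_eq_neg_four_pow_mul (by exact_mod_cast hc) h (show j + 1 ≤ k + (j + 1) by omega),
    ← Nat.choose_symm_add,
    show 2 * (k : F) + 1 = -(2 * (j + 1)) by linear_combination hc,
    show (-16 : F) = 4 * -4 by norm_num, mul_pow, neg_pow (4 : F) (j + 1), neg_pow (4 : F) k]
  rw [pow_add] at h4
  have p4 : (4 : F) ^ k ≠ 0 := pow_ne_zero _ f4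
  have p4' : (4 : F) ^ (j + 1) ≠ 0 := pow_ne_zero _ f4
  have n1 : (-1 : F) ^ k ≠ 0 := pow_ne_zero _ (by norm_num)
  have n2 : (-1 : F) ^ (j + 1) ≠ 0 := pow_ne_zero _ (by norm_num)
  rw [show (4 : F) ^ k = ((4 : F) ^ (j + 1))⁻¹ from eq_inv_of_mul_eq_one_left h4]
  generalize (4 : F) ^ (j + 1) = q at *
  generalize (-1 : F) ^ (j + 1) = e at *
  generalize (-1 : F) ^ k = e' at *
  field_simp
  ring

lemma hasReduction_sum_neg_sixteen_pow_div {p n : ℕ} [Fact p.Prime] (hn : p = 2 * n + 1) :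
    HasReduction p
      (∑ k ∈ Finset.range n,
        (-16 : ℚ) ^ k / ((2 * (k : ℚ) + 1) ^ 3 * (Nat.choose (2 * k) k : ℚ)))
      (∑ k ∈ Finset.range n,
        (-16 : ZMod p) ^ k / ((2 * (k : ZMod p) + 1) ^ 3 * ((2 * k).choose k : ZMod p))) := by
  refine HasReduction.sum _ fun k hk => ?_
  rw [Finset.mem_range] at hk
  have h : ∀ m : ℕ, 0 < m → m ≤ 2 * n → (m : ZMod p) ≠ 0 := fun m h1 h2 =>
    natCast_zmod_ne_zero_of_lt h1 (by omega)
  have hd := ((HasReduction.natCast (p := p) (2 * k + 1)).pow 3).mul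
    (HasReduction.natCast ((2 * k).choose k))
  have := ((HasReduction.intCast (p := p) (-16)).pow k).div hd
    (mul_ne_zero (pow_ne_zero _ (h _ (by omega) (by omega)))
      (choose_cast_ne_zero_of_le h (by omega) (by omega)))
  simpa using this

lemma two_mul_half_add_one_zmod {p n : ℕ} (hn : p = 2 * n + 1) : 2 * (n : ZMod p) + 1 = 0 := by
  have h := congrArg (Nat.cast : ℕ → ZMod p) hn
  rw [ZMod.natCast_self] at h
  push_cast at h
  exact h.symm

lemma four_pow_half_zmod {p n : ℕ} [Fact p.Prime] (hn : p = 2 * n + 1) (hp : 2 < p) :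
    (4 : ZMod p) ^ n = 1 := by
  have h2 : (2 : ZMod p) ≠ 0 := by
    exact_mod_cast natCast_zmod_ne_zero_of_lt (p := p) two_pos hp
  rw [show (4 : ZMod p) = 2 ^ 2 by norm_num, ← pow_mul, show 2 * n = p - 1 by omega,
    ZMod.pow_card_sub_one_eq_one h2]

lemma hasReduction_upper_centralBinom_sum {p n : ℕ} [Fact p.Prime] (hn : p = 2 * n + 1)
    (hp : 2 < p) :
    HasReduction p
      ((1 / (p : ℚ)) * ∑ k ∈ Finset.Icc (n + 1) (2 * n),
        (Nat.choose (2 * k) k : ℚ) / ((2 * (k : ℚ) + 1) ^ 2 * (-16 : ℚ) ^ k))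
      (-∑ k ∈ Finset.range n,
        (-16 : ZMod p) ^ k / ((2 * (k : ZMod p) + 1) ^ 3 * ((2 * k).choose k : ZMod p))) := by
  have h : ∀ m : ℕ, 0 < m → m ≤ 2 * n → (m : ZMod p) ≠ 0 := fun m h1 h2 =>
    natCast_zmod_ne_zero_of_lt h1 (by omega)
  have hp0 : (p : ℚ) ≠ 0 := by exact_mod_cast (Fact.out : p.Prime).ne_zero
  have h16 : (-16 : ZMod p) ^ (2 * n) = 1 := by
    rw [pow_mul, show ((-16 : ZMod p) ^ 2) = 4 ^ 4 by norm_num, ← pow_mul, mul_comm, pow_mul,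
      four_pow_half_zmod hn hp, one_pow]
  have h16' : (-16 : ZMod p) ≠ 0 := by
    intro h0
    rw [h0, zero_pow (by omega)] at h16
    exact zero_ne_one h16
  have hc : 2 * (n : ZMod p) + 1 = 0 := two_mul_half_add_one_zmod hn
  have e : ∑ k ∈ Finset.Icc (n + 1) (2 * n),
        (Nat.choose (2 * k) k : ℚ) / ((2 * (k : ℚ) + 1) ^ 2 * (-16 : ℚ) ^ k) =
      ∑ j ∈ Finset.range n, (Nat.choose (2 * (2 * n - j)) (2 * n - j) : ℚ) /
        ((2 * ((2 * n - j : ℕ) : ℚ) + 1) ^ 2 * (-16 : ℚ) ^ (2 * n - j)) := by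
    refine Finset.sum_nbij' (fun k => 2 * n - k) (fun j => 2 * n - j) ?_ ?_ ?_ ?_ ?_
    · intro k hk; simp only [Finset.mem_Icc, Finset.mem_range] at hk ⊢; omega
    · intro k hk; simp only [Finset.mem_Icc, Finset.mem_range] at hk ⊢; omega
    · intro k hk; simp only [Finset.mem_Icc] at hk; omega
    · intro k hk; simp only [Finset.mem_range] at hk; omega
    · intro k hk
      simp only [Finset.mem_Icc] at hk
      rw [show 2 * n - (2 * n - k) = k by omega]
  rw [e, Finset.mul_sum, ← Finset.sum_neg_distrib]
  refine HasReduction.sum _ fun j hj => ?_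
  rw [Finset.mem_range] at hj
  obtain ⟨m, hm, hm1⟩ := exists_centralBinom_eq_prime_mul (p := p) (j := j) (by omega)
  rw [show p - 1 - j = 2 * n - j by omega] at hm
  have hk : 2 * ((2 * n - j : ℕ) : ZMod p) + 1 = -(2 * j + 1) := by
    rw [Nat.cast_sub (by omega)]
    push_cast
    linear_combination 2 * hc
  have hj1 : 2 * (j : ZMod p) + 1 ≠ 0 := by exact_mod_cast h (2 * j + 1) (by omega) (by omega)
  have hcj : ((2 * j).choose j : ZMod p) ≠ 0 := choose_cast_ne_zero_of_le h (by omega) (by omega)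
  have hd := ((HasReduction.natCast (p := p) (2 * (2 * n - j) + 1)).pow 2).mul
    ((HasReduction.intCast (p := p) (-16)).pow (2 * n - j))
  have hdiv := (HasReduction.natCast m).div hd (by
    push_cast
    rw [hk]
    exact mul_ne_zero (pow_ne_zero _ (neg_ne_zero.2 hj1)) (pow_ne_zero _ h16'))
  push_cast at hdiv
  rw [hk] at hdiv
  convert hdiv using 1
  · rw [hm]
    push_cast
    field_simp
  -- Since `(-16)^(p-1) = 1`, the power moves from denominator to numerator.
  · have hs : (-16 : ZMod p) ^ (2 * n - j) = ((-16) ^ j)⁻¹ := by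
      apply eq_inv_of_mul_eq_one_left
      rw [← pow_add, Nat.sub_add_cancel (by omega), h16]
    have hp16 : (-16 : ZMod p) ^ j ≠ 0 := pow_ne_zero _ h16'
    rw [hs, neg_sq]
    generalize (-16 : ZMod p) ^ j = q at *
    field_simp
    linear_combination -hm1

theorem corollary1p1 (p : ℕ) (hp : p.Prime) (hp5 : 5 < p) :
    RatCongr p
      ((1 / (p : ℚ)) * ∑ k ∈ Finset.Icc ((p + 1) / 2) (p - 1),
        (Nat.choose (2 * k) k : ℚ) / ((2 * (k : ℚ) + 1) ^ 2 * (-16 : ℚ) ^ k))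
      (-∑ k ∈ Finset.Icc 0 ((p - 3) / 2),
        (-16 : ℚ) ^ k / ((2 * (k : ℚ) + 1) ^ 3 * (Nat.choose (2 * k) k : ℚ))) ∧
    RatCongr p
      (-∑ k ∈ Finset.Icc 0 ((p - 3) / 2),
        (-16 : ℚ) ^ k / ((2 * (k : ℚ) + 1) ^ 3 * (Nat.choose (2 * k) k : ℚ)))
      (-bernoulli (p - 3) / 4) := by
  have : Fact p.Prime := ⟨hp⟩
  obtain ⟨n, hn⟩ : ∃ n, p = 2 * n + 1 := by
    rcases hp.eq_two_or_odd' with h | ⟨n, h⟩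
    · omega
    · exact ⟨n, h⟩
  have hI : Finset.Icc 0 ((p - 3) / 2) = Finset.range n := by
    ext k
    rw [Finset.mem_Icc, Finset.mem_range]
    omega
  rw [hI, show (p + 1) / 2 = n + 1 by omega, show p - 1 = 2 * n by omega]
  have hc : 2 * (n : ZMod p) + 1 = 0 := two_mul_half_add_one_zmod hn
  have h : ∀ m : ℕ, 0 < m → m ≤ 2 * n → (m : ZMod p) ≠ 0 := fun m h1 h2 =>
    natCast_zmod_ne_zero_of_lt h1 (by omega)
  have h2 : (2 : ZMod p) ≠ 0 := by exact_mod_cast h 2 (by omega) (by omega)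
  have h4 : (4 : ZMod p) ≠ 0 := by exact_mod_cast h 4 (by omega) (by omega)
  have hH : powHarmonic (ZMod p) 2 n = 0 := by
    have := powHarmonic_two_two_mul hc
    rw [show 2 * n = p - 1 by omega, powHarmonic_two_zmod (by omega), eq_comm, mul_eq_zero,
      or_iff_right h2] at this
    exact this
  have hlow := (hasReduction_sum_neg_sixteen_pow_div hn).neg
  refine ⟨(hasReduction_upper_centralBinom_sum hn (by omega)).ratCongr hlow, hlow.ratCongr ?_⟩
  rw [sum_neg_sixteen_pow_div_odd_cube hc h h2 (four_pow_half_zmod hn (by omega)),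
    sum_neg_one_pow_div_cube_mul_centralBinom hc h (by omega) hH]
  have hB := hasReduction_bernoulli_harmonicSum (p := p) (by omega)
  have := hB.neg.div (HasReduction.natCast 4) (by exact_mod_cast h4)
  rw [show p - 1 = 2 * n by omega] at this
  have h8 : (8 : ZMod p) = 2 * 4 := by norm_num
  have e : -(-(-2 * harmonicSum (ZMod p) (2 * n)) / 8) =
      -harmonicSum (ZMod p) (2 * n) / (4 : ℕ) := by
    rw [h8]
    push_cast
    field_simp
  rw [e]
  exact_mod_cast this
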